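/- Let $\mathbf{FI}$ be the category of finite sets and injections, let $k$ be a ring (for instance $k=\mathbb{Z}$), and let an $\mathbf{FI}$-module be a functor $V$ from $\mathbf{FI}$ to $k$-modules; write $V_n = V_{\{1,\dots,n\}}$. The degree $\deg(V)\in\{-1,0,1,\dots\}\cup\{\infty\}$ is the least $d\ge -1$ such that $V_S=0$ for every finite set $S$ with $|S|>d$. Let $\mathrm{H}^0_{\mathfrak m}$ be the left exact functor sending an $\mathbf{FI}$-module $V$ to its largest torsion $\mathbf{FI}$-submodule, that is, the submodule of those $x\in V_S$ that are sent to $0$ by the map $V_S\to V_T$ induced by some injection $S\to T$. For $j\ge 0$ let $\mathrm{H}^j_{\mathfrak m}=\mathrm{R}^j\mathrm{H}^0_{\mathfrak m}$ be its right derived functors (local cohomology) and put $h^j(V)=\deg(\mathrm{H}^j_{\mathfrak m}(V))$. Let $V$ be an $\mathbf{FI}$-module and $N\ge 0$ an integer, and let $V_{\ge N}$ be the unique $\mathbf{FI}$-submodule of $V$ with $(V_{\ge N})_n=0$ for $n<N$ and $(V_{\ge N})_n=V_n$ for $n\ge N$. Then \begin{itemize} \item $h^0(V_{\ge N})\le h^0(V)\le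 \max\{h^0(V_{\ge N}),\,N-1\}$, \item $h^1(V)\le h^1(V_{\ge N})\le \max\{N-1,\,h^1(V)\}$, \item $h^j(V)=h^j(V_{\ge N})$ for every $j\ge 2$. \end{itemize} -/

import Mathlib

open CategoryTheory CategoryTheory.Limits

universe u

/-- A finite set, as an object of the category `FI`. -/
structure FI where
  /-- the underlying set -/
  carrier : Type
  [finite : Finite carrier]

namespace FI

instance : CoeSort FI Type := ⟨FI.carrier⟩

instance (S : FI) : Finite S := S.finite

/-- The category of finite sets and injections. -/
instance : Category.{0} FI where
  Hom S T := S ↪ T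
  id S := Function.Embedding.refl S
  comp f g := f.trans g

/-- The standard finite set with `n` elements. -/
def std (n : ℕ) : FI := ⟨Fin n⟩

/-- The number of elements of a finite set. -/
noncomputable def card (S : FI) : ℕ := Nat.card S.carrier

theorem card_std (n : ℕ) : (std n).card = n := by simp [std, card]

theorem card_le {S T : FI} (f : S ⟶ T) : S.card ≤ T.card :=
  have f' : S.carrier ↪ T.carrier := f
  Nat.card_le_card_of_injective f' f'.injective

theorem exists_iso_std (S : FI) : Nonempty (S ≅ std S.card) := by
  let e : S.carrier ≃ Fin (Nat.card S.carrier) := Finite.equivFin S.carrier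
  exact ⟨{ hom := e.toEmbedding
           inv := e.symm.toEmbedding
           hom_inv_id := Function.Embedding.ext fun x => e.symm_apply_apply x
           inv_hom_id := Function.Embedding.ext fun x => e.apply_symm_apply x }⟩

/-- Two injections with the same source can be completed to a commutative square. -/
theorem exists_amalgam {S T U : FI} (f : S ⟶ T) (g : S ⟶ U) :
    ∃ (W : FI) (a : T ⟶ W) (b : U ⟶ W), f ≫ a = g ≫ b := by
  classical
  let f' : S.carrier ↪ T.carrier := f
  let g' : S.carrier ↪ U.carrier := g
  let a : T.carrier → U.carrier ⊕ T.carrier := fun t =>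
    if h : ∃ s, f' s = t then Sum.inl (g' h.choose) else Sum.inr t
  have ha : Function.Injective a := by
    intro t t' h
    by_cases h1 : ∃ s, f' s = t <;> by_cases h2 : ∃ s, f' s = t'
    · simp only [a, h1, h2, dif_pos, Sum.inl.injEq] at h
      rw [← h1.choose_spec, ← h2.choose_spec, g'.injective h]
    · simp [a, dif_pos h1, dif_neg h2] at h
    · simp [a, dif_neg h1, dif_pos h2] at h
    · simpa only [a, dif_neg h1, dif_neg h2, Sum.inr.injEq] using h
  refine ⟨⟨U.carrier ⊕ T.carrier⟩, (⟨a, ha⟩ : T.carrier ↪ U.carrier ⊕ T.carrier),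
    (⟨Sum.inl, Sum.inl_injective⟩ : U.carrier ↪ U.carrier ⊕ T.carrier), ?_⟩
  refine Function.Embedding.ext fun s => ?_
  change a (f' s) = Sum.inl (g' s)
  have h : ∃ s', f' s' = f' s := ⟨s, rfl⟩
  simp only [a, dif_pos h]
  rw [f'.injective h.choose_spec]

end FI

/-- `FI`-modules over the ring `k`: functors from `FI` to `k`-modules. -/
abbrev FIMod (k : Type u) [Ring k] := FI ⥤ ModuleCat.{u} k

namespace FIMod

variable {k : Type u} [Ring k]

/-- An `FI`-submodule of `V`: a family of submodules of the `V_S` that is preserved by all the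
structure maps. -/
@[ext]
structure Sub (V : FIMod k) where
  /-- the submodule of `V_S` -/
  carrier : ∀ S : FI, Submodule k (V.obj S)
  map_mem : ∀ {S T : FI} (f : S ⟶ T) (x : V.obj S), x ∈ carrier S → V.map f x ∈ carrier T

/-- An `FI`-submodule, as an `FI`-module in its own right. -/
def Sub.toFIMod {V : FIMod k} (U : V.Sub) : FIMod k where
  obj S := ModuleCat.of k (U.carrier S)
  map {S T} f := ModuleCat.ofHom ((V.map f).hom.restrict (p := U.carrier S) (q := U.carrier T)
    fun x hx => U.map_mem f x hx)
  map_id S := by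
    ext x
    change V.map (𝟙 S) x.1 = x.1
    simp
  map_comp {S T W} f g := by
    ext x
    change V.map (f ≫ g) x.1 = V.map g (V.map f x.1)
    simp

/-- The truncation `V_{≥ N}`: the `FI`-submodule of `V` which is `V_S` for `|S| ≥ N` and `0` for
`|S| < N`. -/
noncomputable def truncSub (V : FIMod k) (N : ℕ) : V.Sub where
  carrier S := if N ≤ S.card then ⊤ else ⊥
  map_mem {S T} f x hx := by
    by_cases h1 : N ≤ S.card
    · rw [if_pos (h1.trans (FI.card_le f))]
      trivial
    · rw [if_neg h1, Submodule.mem_bot] at hx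
      rw [hx, map_zero]
      exact Submodule.zero_mem _

/-- The truncation `V_{≥ N}` as an `FI`-module. -/
noncomputable def trunc (V : FIMod k) (N : ℕ) : FIMod k := (V.truncSub N).toFIMod

theorem truncSub_unique (V : FIMod k) (N : ℕ) (U : V.Sub)
    (h0 : ∀ n < N, U.carrier (FI.std n) = ⊥) (h1 : ∀ n ≥ N, U.carrier (FI.std n) = ⊤) :
    U = V.truncSub N := by
  have key : ∀ {S T : FI} (e : S ≅ T) (x : V.obj S),
      V.map e.hom x ∈ U.carrier T → x ∈ U.carrier S := by
    intro S T e x hx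
    have h := U.map_mem e.inv _ hx
    rwa [← ModuleCat.comp_apply, ← V.map_comp, e.hom_inv_id, V.map_id] at h
  ext S x
  obtain ⟨e⟩ := S.exists_iso_std
  simp only [truncSub]
  split_ifs with h
  · refine iff_of_true (key e x ?_) trivial
    rw [h1 _ h]
    trivial
  · rw [Submodule.mem_bot]
    refine ⟨fun hx => ?_, fun hx => hx ▸ Submodule.zero_mem _⟩
    have h2 := U.map_mem e.hom x hx
    rw [h0 _ (not_le.mp h), Submodule.mem_bot] at h2
    have h3 : V.map e.inv (V.map e.hom x) = x := by
      rw [← ModuleCat.comp_apply, ← V.map_comp, e.hom_inv_id, V.map_id]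
      rfl
    rw [← h3, h2, map_zero]

/-- The largest torsion `FI`-submodule of `V`: it consists of the `x ∈ V_S` that are sent to `0`
by the map `V_S → V_T` induced by some injection `S → T`. -/
def torsionSub (V : FIMod k) : V.Sub where
  carrier S :=
    { carrier := {x | ∃ (T : FI) (f : S ⟶ T), V.map f x = 0}
      zero_mem' := ⟨S, 𝟙 S, map_zero _⟩
      add_mem' := by
        rintro x y ⟨T, f, hf⟩ ⟨T', g, hg⟩
        obtain ⟨W, a, b, hab⟩ := FI.exists_amalgam f g
        refine ⟨W, f ≫ a, ?_⟩
        rw [map_add]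
        nth_rewrite 2 [hab]
        simp [hf, hg]
      smul_mem' := by
        rintro c x ⟨T, f, hf⟩
        exact ⟨T, f, by rw [map_smul, hf, smul_zero]⟩ }
  map_mem := by
    rintro S T f x ⟨U, g, hg⟩
    obtain ⟨W, a, b, hab⟩ := FI.exists_amalgam f g
    refine ⟨W, a, ?_⟩
    rw [← ModuleCat.comp_apply, ← V.map_comp, hab]
    simp [hg]

/-- The functor `H⁰_𝔪`, which sends an `FI`-module to its largest torsion `FI`-submodule. -/
def torsion (k : Type u) [Ring k] : FIMod k ⥤ FIMod k where
  obj V := V.torsionSub.toFIMod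
  map {V W} φ :=
    { app S := ModuleCat.ofHom ((φ.app S).hom.restrict
        (p := V.torsionSub.carrier S) (q := W.torsionSub.carrier S) (by
          rintro x ⟨T, f, hf⟩
          refine ⟨T, f, ?_⟩
          have h : W.map f (φ.app S x) = φ.app T (V.map f x) := by
            rw [← ModuleCat.comp_apply, ← ModuleCat.comp_apply, φ.naturality]
          exact h.trans (by rw [hf, map_zero])))
      naturality S T f := by
        ext x
        apply Subtype.ext
        change φ.app T (V.map f x.1) = W.map f (φ.app S x.1)
        rw [← ModuleCat.comp_apply, ← ModuleCat.comp_apply, φ.naturality] }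
  map_id V := rfl
  map_comp φ ψ := rfl

instance torsion_additive (k : Type u) [Ring k] : (torsion k).Additive where
  map_add := rfl

/-- The category of `FI`-modules has enough injectives. -/
instance enoughInjectives (k : Type u) [Ring k] : EnoughInjectives (FIMod k) where
  presentation V := by
    let J : ℕ → FIMod k := fun n =>
      (evaluationRightAdjoint (ModuleCat.{u} k) (FI.std n)).obj
        (Injective.under (V.obj (FI.std n)))
    have hJ : ∀ n, Injective (J n) := fun n =>
      Injective.injective_of_adjoint (evaluationAdjunctionLeft (ModuleCat.{u} k) (FI.std n)) _
    let ι : ∀ n, V ⟶ J n := fun n =>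
      (evaluationAdjunctionLeft (ModuleCat.{u} k) (FI.std n)).homEquiv V _
        (Injective.ι (V.obj (FI.std n)))
    have hι : ∀ n, Mono ((ι n).app (FI.std n)) := fun n => by
      have h := (evaluationAdjunctionLeft (ModuleCat.{u} k) (FI.std n)).homEquiv_counit
        (g := ι n)
      have h' : (ι n).app (FI.std n) ≫ (evaluationAdjunctionLeft (ModuleCat.{u} k)
          (FI.std n)).counit.app (Injective.under (V.obj (FI.std n))) =
          Injective.ι (V.obj (FI.std n)) := by
        rw [← (Equiv.symm_apply_apply ((evaluationAdjunctionLeft (ModuleCat.{u} k)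
          (FI.std n)).homEquiv V _) (Injective.ι (V.obj (FI.std n)))), h]
        rfl
      have : Mono ((ι n).app (FI.std n) ≫ (evaluationAdjunctionLeft (ModuleCat.{u} k)
          (FI.std n)).counit.app (Injective.under (V.obj (FI.std n)))) := by
        rw [h']; infer_instance
      exact mono_of_mono _ ((evaluationAdjunctionLeft (ModuleCat.{u} k)
          (FI.std n)).counit.app (Injective.under (V.obj (FI.std n))))
    have hm : Mono (Pi.lift ι) := by
      have : ∀ S, Mono ((Pi.lift ι).app S) := by
        intro S
        obtain ⟨e⟩ := S.exists_iso_std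
        have h1 : (Pi.lift ι).app S ≫ (Pi.π J S.card).app S = (ι S.card).app S := by
          rw [← NatTrans.comp_app, Pi.lift_π]
        have h2 : (ι S.card).app S = V.map e.hom ≫ (ι S.card).app (FI.std S.card) ≫
            (J S.card).map e.inv := by
          rw [← (ι S.card).naturality, ← V.map_comp_assoc, e.hom_inv_id, V.map_id,
            Category.id_comp]
        have h3 : Mono ((Pi.lift ι).app S ≫ (Pi.π J S.card).app S) := by
          rw [h1, h2]; infer_instance
        exact mono_of_mono _ ((Pi.π J S.card).app S)
      exact NatTrans.mono_of_mono_app _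
    exact ⟨{ J := ∏ᶜ J, injective := inferInstance, f := Pi.lift ι, mono := hm }⟩

/-- The local cohomology functors `H^j_𝔪`, the right derived functors of `H⁰_𝔪`. -/
noncomputable def locoh (k : Type u) [Ring k] (j : ℕ) : FIMod k ⥤ FIMod k :=
  (torsion k).rightDerived j

/-- The degree of an `FI`-module, in `{-1, 0, 1, …} ∪ {∞}`: the least `d ≥ -1` such that `V_S = 0`
for all finite sets `S` with more than `d` elements. -/
noncomputable def degree (V : FIMod k) : WithTop ℤ :=
  sInf {d | ((-1 : ℤ) : WithTop ℤ) ≤ d ∧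
    ∀ S : FI, d < ((S.card : ℤ) : WithTop ℤ) → Subsingleton (V.obj S)}

/-- The local cohomology degrees `h^j(V) = deg H^j_𝔪(V)`. -/
noncomputable def locohDegree (j : ℕ) (V : FIMod k) : WithTop ℤ :=
  degree ((locoh k j).obj V)

theorem degree_le_iff (V : FIMod k) (d : WithTop ℤ) :
    V.degree ≤ d ↔ ((-1 : ℤ) : WithTop ℤ) ≤ d ∧
      ∀ S : FI, d < ((S.card : ℤ) : WithTop ℤ) → Subsingleton (V.obj S) := by
  set A : Set (WithTop ℤ) := {d | ((-1 : ℤ) : WithTop ℤ) ≤ d ∧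
    ∀ S : FI, d < ((S.card : ℤ) : WithTop ℤ) → Subsingleton (V.obj S)} with hA
  have hb : BddBelow A := ⟨((-1 : ℤ) : WithTop ℤ), fun d hd => hd.1⟩
  have hne : A.Nonempty := ⟨⊤, le_top, fun S h => absurd h not_top_lt⟩
  constructor
  · intro h
    refine ⟨(le_csInf hne fun d hd => hd.1).trans h, fun S hS => ?_⟩
    obtain ⟨e, he, hlt⟩ := exists_lt_of_csInf_lt hne (h.trans_lt hS)
    exact he.2 S hlt
  · intro h
    exact csInf_le hb h

end FIMod

/-!
The quotient `Q = V / V_{≥ N}` vanishes on all sets with at least `N` elements. Such a module is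
torsion and embeds into an injective module with the same vanishing property, namely the product
over `n < N` of the modules coinduced from injective `k`-modules containing `Q_n`. Since quotients
inherit the vanishing and `H⁰_𝔪` is the identity on torsion modules, dimension shifting gives
`H^j_𝔪(Q) = 0` for `j ≥ 1`, while `H⁰_𝔪(Q)` has degree at most `N - 1`. The comparison of `V` with
`V_{≥ N}` is then read off the long exact sequence of `0 → V_{≥ N} → V → Q → 0`.

The long exact sequence comes from the injective objects `T₀ ⟶ T₁` of the category of arrows:
these are split epimorphisms between injective objects, so an injective resolution of the arrow
`S.g` is a degreewise split epimorphism between injective resolutions, and its kernel resolves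
`S.X₁`.
-/

universe v u' v' w

section CoinducedHull

variable {J : Type u} [Category.{v} J] {C : Type u'} [Category.{v'} C]
  [∀ a b : J, HasProductsOfShape (a ⟶ b) C]

theorem mono_app_evaluation_homEquiv {V : J ⥤ C} {j : J} {A : C} (i : V.obj j ⟶ A) [Mono i] :
    Mono (((evaluationAdjunctionLeft C j).homEquiv V A i).app j) := by
  have h := ((evaluationAdjunctionLeft C j).homEquiv V A).symm_apply_apply i
  rw [Adjunction.homEquiv_counit] at h
  exact mono_of_mono_fac h

variable [EnoughInjectives C] {I : Type w} [HasProductsOfShape I C]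

/-- The product of the functors coinduced from injective objects containing the values of `V` at
the objects `a i`. It is an injective functor that receives a map from `V` which is a monomorphism
at every `a i`. -/
noncomputable def coinducedHull (V : J ⥤ C) (a : I → J) : J ⥤ C :=
  ∏ᶜ fun i => (evaluationRightAdjoint C (a i)).obj (Injective.under (V.obj (a i)))

namespace coinducedHull

variable (V : J ⥤ C) (a : I → J)

instance [HasPullbacks C] : Injective (coinducedHull V a) :=
  have (i : I) := Injective.injective_of_adjoint (evaluationAdjunctionLeft C (a i))
    (Injective.under (V.obj (a i)))
  inferInstanceAs (Injective (∏ᶜ _))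

/-- The canonical map from a functor to its coinduced hull. -/
noncomputable def ι : V ⟶ coinducedHull V a :=
  Pi.lift fun i => (evaluationAdjunctionLeft C (a i)).homEquiv V _ (Injective.ι (V.obj (a i)))

/-- The projections of the coinduced hull onto its factors. -/
noncomputable def π (i : I) :
    coinducedHull V a ⟶ (evaluationRightAdjoint C (a i)).obj (Injective.under (V.obj (a i))) :=
  Pi.π _ i

theorem ι_π (i : I) :
    ι V a ≫ π V a i =
      (evaluationAdjunctionLeft C (a i)).homEquiv V _ (Injective.ι (V.obj (a i))) :=
  Pi.lift_π _ i

theorem mono_ι_app (i : I) : Mono ((ι V a).app (a i)) := by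
  have := mono_app_evaluation_homEquiv (Injective.ι (V.obj (a i)))
  rw [← ι_π, NatTrans.comp_app] at this
  exact mono_of_mono _ ((π V a i).app (a i))

theorem mono_ι (h : ∀ X, (∃ i, Nonempty (X ≅ a i)) ∨ IsZero (V.obj X)) : Mono (ι V a) := by
  refine @NatTrans.mono_of_mono_app _ _ _ _ _ _ _ fun X => ?_
  obtain ⟨i, ⟨e⟩⟩ | hX := h X
  · have := mono_ι_app V a i
    have h_app : (ι V a).app X =
        V.map e.hom ≫ (ι V a).app (a i) ≫ (coinducedHull V a).map e.inv := by
      simp [← Functor.map_comp]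
    rw [h_app]
    infer_instance
  · exact ⟨fun _ _ _ => hX.eq_of_tgt _ _⟩

theorem isZero_obj [HasZeroMorphisms C] (X : J) [∀ i, IsEmpty (X ⟶ a i)] :
    IsZero ((coinducedHull V a).obj X) := by
  rw [IsZero.iff_id_eq_zero]
  refine (isLimitOfPreserves ((evaluation J C).obj X) (productIsProduct _)).hom_ext fun ⟨i⟩ => ?_
  exact Pi.hom_ext _ _ fun g => isEmptyElim g

end coinducedHull

theorem enoughInjectives_functor [HasPullbacks C] [HasProductsOfShape J C] :
    EnoughInjectives (J ⥤ C) where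
  presentation V :=
    have := coinducedHull.mono_ι V id fun X => .inl ⟨X, ⟨Iso.refl X⟩⟩
    ⟨{ J := coinducedHull V id, f := coinducedHull.ι V id }⟩

end CoinducedHull

section InjectiveArrow

open ComposableArrows ZeroObject

variable {C : Type*} [Category* C]

theorem exists_square_extension (T : ComposableArrows C 1) [Injective T] {A₀ A₁ B₀ B₁ : C}
    {α : A₀ ⟶ A₁} {β : B₀ ⟶ B₁} (m₀ : A₀ ⟶ B₀) (m₁ : A₁ ⟶ B₁) [Mono m₀] [Mono m₁]
    (hm : α ≫ m₁ = m₀ ≫ β) (t₀ : A₀ ⟶ T.left) (t₁ : A₁ ⟶ T.right) (ht : α ≫ t₁ = t₀ ≫ T.hom) :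
    ∃ (s₀ : B₀ ⟶ T.left) (s₁ : B₁ ⟶ T.right),
      m₀ ≫ s₀ = t₀ ∧ m₁ ≫ s₁ = t₁ ∧ β ≫ s₁ = s₀ ≫ T.hom := by
  let m : mk₁ α ⟶ mk₁ β := homMk₁ m₀ m₁ hm
  let t : mk₁ α ⟶ T := homMk₁ t₀ t₁ ht
  have : Mono m := @NatTrans.mono_of_mono_app _ _ _ _ _ _ _ fun i => by
    fin_cases i <;> assumption
  let s := Injective.factorThru t m
  have hs : m ≫ s = t := Injective.comp_factorThru t m
  exact ⟨s.app 0, s.app 1, congr_app hs 0, congr_app hs 1, naturality' s 0 1⟩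

theorem injective_left (T : ComposableArrows C 1) [Injective T] : Injective T.left where
  factors {X Y} g m _ :=
    have ⟨s, _, hs, _⟩ := exists_square_extension T (α := 𝟙 X) (β := 𝟙 Y) m m (by simp)
      g (g ≫ T.hom) (by simp)
    ⟨s, hs⟩

variable [HasZeroMorphisms C] [HasZeroObject C]

theorem injective_right (T : ComposableArrows C 1) [Injective T] : Injective T.right where
  factors {X Y} g m _ :=
    have ⟨_, s, _, hs, _⟩ := exists_square_extension T (α := 0) (β := 0) (𝟙 (0 : C)) m (by simp)
      0 g (by simp)
    ⟨s, hs⟩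

theorem isSplitEpi_hom (T : ComposableArrows C 1) [Injective T] : IsSplitEpi T.hom :=
  have ⟨s₀, s₁, _, h₁, h⟩ := exists_square_extension T (A₀ := 0) (α := 0) (β := 𝟙 _) 0 (𝟙 _)
    (by simp) 0 (𝟙 _) (by simp)
  ⟨s₀, by simpa [← h] using h₁⟩

instance (i : Fin 2) : ((evaluation (Fin 2) C).obj i).PreservesInjectiveObjects where
  injective_obj {T} _ := by
    fin_cases i
    exacts [injective_left T, injective_right T]

end InjectiveArrow

section MapInjectiveResolution

variable {C : Type*} [Category* C] [HasZeroObject C] [Preadditive C]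
  {D : Type*} [Category* D] [HasZeroObject D] [Preadditive D] [CategoryWithHomology D]

/-- The image of an injective resolution under an exact additive functor that preserves injective
objects. -/
noncomputable def mapInjectiveResolution (F : C ⥤ D) [F.Additive] [F.PreservesInjectiveObjects]
    [F.PreservesHomology] {Z : C} (I : InjectiveResolution Z) :
    InjectiveResolution (F.obj Z) where
  cocomplex := (F.mapHomologicalComplex _).obj I.cocomplex
  injective n := F.injective_obj_of_injective (I.injective n)
  ι := (HomologicalComplex.singleMapHomologicalComplex _ _ _).inv.app _ ≫
    (F.mapHomologicalComplex _).map I.ι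
  quasiIso := inferInstance

theorem mapInjectiveResolution_ι_f_zero (F : C ⥤ D) [F.Additive] [F.PreservesInjectiveObjects]
    [F.PreservesHomology] {Z : C} (I : InjectiveResolution Z) :
    (mapInjectiveResolution F I).ι.f 0 = F.map (I.ι.f 0) := by
  simp only [mapInjectiveResolution, HomologicalComplex.comp_f,
    HomologicalComplex.singleMapHomologicalComplex_inv_app_self,
    HomologicalComplex.singleObjXSelf, HomologicalComplex.singleObjXIsoOfEq,
    Functor.mapHomologicalComplex_map_f]
  change (𝟙 _ ≫ F.map (𝟙 _)) ≫ _ = _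
  rw [F.map_id, Category.comp_id]
  exact Category.id_comp _

/-- The morphism of injective resolutions given by a natural transformation between exact
additive functors that preserve injective objects. -/
noncomputable def mapInjectiveResolutionHom {F G : C ⥤ D} [F.Additive]
    [F.PreservesInjectiveObjects] [F.PreservesHomology] [G.Additive]
    [G.PreservesInjectiveObjects] [G.PreservesHomology] (τ : F ⟶ G) {Z : C}
    (I : InjectiveResolution Z) :
    (mapInjectiveResolution F I).Hom (mapInjectiveResolution G I) (τ.app Z) where
  hom := (NatTrans.mapHomologicalComplex τ _).app I.cocomplex
  ι_f_zero_comp_hom_f_zero := by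
    rw [mapInjectiveResolution_ι_f_zero, mapInjectiveResolution_ι_f_zero,
      CochainComplex.single₀_map_f_zero]
    exact τ.naturality (I.ι.f 0)

end MapInjectiveResolution

section QuasiIso

open HomologicalComplex HomologicalComplex.HomologySequence ComposableArrows Abelian

variable {C ι : Type*} [Category* C] [Abelian C] {c : ComplexShape ι}
  {S₁ S₂ : ShortComplex (HomologicalComplex C c)}

theorem isIso_homologyMap_τ₁_of_rel (φ : S₁ ⟶ S₂) (hS₁ : S₁.ShortExact) (hS₂ : S₂.ShortExact)
    {i j : ι} (hij : c.Rel i j) [Epi (homologyMap φ.τ₂ i)] [IsIso (homologyMap φ.τ₃ i)]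
    [IsIso (homologyMap φ.τ₂ j)] [Mono (homologyMap φ.τ₃ j)] : IsIso (homologyMap φ.τ₁ j) :=
  isIso_of_epi_of_isIso_of_isIso_of_mono (composableArrows₅_exact hS₁ i j hij).δ₀
    (composableArrows₅_exact hS₂ i j hij).δ₀
    (δ₀Functor.map (mapComposableArrows₅ φ hS₁ hS₂ i j hij)) ‹_› ‹_› ‹_› ‹_›

theorem isIso_homologyMap_τ₁_of_not_rel (φ : S₁ ⟶ S₂) (hS₁ : S₁.ShortExact) (hS₂ : S₂.ShortExact)
    {j : ι} (hj : ∀ i, ¬ c.Rel i j) [IsIso (homologyMap φ.τ₂ j)] [Mono (homologyMap φ.τ₃ j)] :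
    IsIso (homologyMap φ.τ₁ j) := by
  have := hS₁.mono_f
  have := hS₂.mono_f
  have hf₁ : Mono (homologyMap S₁.f j) := mono_homologyMap_of_mono_of_not_rel S₁.f j hj
  have hf₂ : Mono (homologyMap S₂.f j) := mono_homologyMap_of_mono_of_not_rel S₂.f j hj
  let H := homologyFunctor C c j
  let φH : S₁.map H ⟶ S₂.map H := H.mapShortComplex.map φ
  have : Mono (H.map φ.τ₁ ≫ H.map S₂.f) := by
    rw [show H.map φ.τ₁ ≫ H.map S₂.f = _ from φH.comm₁₂]
    exact mono_comp (homologyMap S₁.f j) (homologyMap φ.τ₂ j)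
  have : Mono (homologyMap φ.τ₁ j) := mono_of_mono (H.map φ.τ₁) (H.map S₂.f)
  have : Epi (homologyMap φ.τ₁ j) := ShortComplex.epi_of_mono_of_epi_of_mono φH
    (hS₁.homology_exact₂ j) hf₂ (inferInstanceAs (Epi (homologyMap φ.τ₂ j)))
    ‹Mono (homologyMap φ.τ₃ j)›
  exact isIso_of_mono_of_epi _

theorem quasiIso_τ₁ (φ : S₁ ⟶ S₂) (hS₁ : S₁.ShortExact) (hS₂ : S₂.ShortExact)
    [QuasiIso φ.τ₂] [QuasiIso φ.τ₃] : QuasiIso φ.τ₁ := by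
  simp only [quasiIso_iff, quasiIsoAt_iff_isIso_homologyMap]
  intro j
  by_cases! hj : ∃ i, c.Rel i j
  · obtain ⟨i, hij⟩ := hj
    exact isIso_homologyMap_τ₁_of_rel φ hS₁ hS₂ hij
  · exact isIso_homologyMap_τ₁_of_not_rel φ hS₁ hS₂ hj

end QuasiIso

section Horseshoe

open CochainComplex ComposableArrows

variable {C : Type*} [Category* C] [Abelian C]

theorem exists_injectiveResolution_hom_isSplitEpi [EnoughInjectives C] {X Y : C} (f : X ⟶ Y) :
    ∃ (I : InjectiveResolution X) (J : InjectiveResolution Y) (φ : I.Hom J f),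
      ∀ n, IsSplitEpi (φ.hom.f n) :=
  have : EnoughInjectives (ComposableArrows C 1) := enoughInjectives_functor
  let R := injectiveResolution (mk₁ f)
  ⟨_, _, mapInjectiveResolutionHom ((evaluation (Fin 2) C).map (homOfLE zero_le_one)) R,
    fun n => isSplitEpi_hom (R.cocomplex.X n)⟩

/-- Compatible injective resolutions of the objects of a short complex which form a short exact
sequence of cochain complexes. -/
structure Horseshoe (S : ShortComplex C) where
  /-- the resolution of the first object -/
  res₁ : InjectiveResolution S.X₁
  /-- the resolution of the second object -/
  res₂ : InjectiveResolution S.X₂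
  /-- the resolution of the third object -/
  res₃ : InjectiveResolution S.X₃
  /-- the lift of the first map -/
  f : res₁.Hom res₂ S.f
  /-- the lift of the second map -/
  g : res₂.Hom res₃ S.g
  zero : f.hom ≫ g.hom = 0
  shortExact : (ShortComplex.mk f.hom g.hom zero).ShortExact

theorem nonempty_horseshoe [EnoughInjectives C] {S : ShortComplex C} (hS : S.ShortExact) :
    Nonempty (Horseshoe S) := by
  obtain ⟨I₂, I₃, g, hg⟩ := exists_injectiveResolution_hom_isSplitEpi S.g
  let K := ShortComplex.mk (kernel.ι g.hom) g.hom (kernel.condition _)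
  have hK : K.ShortExact :=
    { exact := ShortComplex.exact_kernel _
      epi_g := HomologicalComplex.epi_of_epi_f _ fun n => inferInstance }
  have hinj (n : ℕ) : Injective (K.X₁.X n) := by
    have := hg n
    let s : I₃.cocomplex.X n ⟶ I₂.cocomplex.X n := section_ (g.hom.f n)
    have hs : s ≫ g.hom.f n = 𝟙 _ := IsSplitEpi.id _
    have hKn := hK.map_of_exact (HomologicalComplex.eval C _ n)
    let σ := ShortComplex.Splitting.ofExactOfSection _ hKn.exact s hs hKn.mono_f
    exact (⟨_, σ.r, σ.f_r⟩ : Retract (K.X₁.X n) (I₂.cocomplex.X n)).injective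
  have hzero : ((single₀ C).map S.f ≫ I₂.ι) ≫ g.hom = 0 := by
    rw [Category.assoc, g.ι_comp_hom, ← Functor.map_comp_assoc, S.zero, Functor.map_zero, zero_comp]
  let φ : S.map (single₀ C) ⟶ K :=
    { τ₁ := kernel.lift _ ((single₀ C).map S.f ≫ I₂.ι) hzero
      τ₂ := I₂.ι
      τ₃ := I₃.ι
      comm₁₂ := kernel.lift_ι _ _ _
      comm₂₃ := g.ι_comp_hom }
  have : QuasiIso φ.τ₂ := I₂.quasiIso
  have : QuasiIso φ.τ₃ := I₃.quasiIso
  have hφ : QuasiIso φ.τ₁ := quasiIso_τ₁ φ (hS.map_of_exact _) hK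
  let I₁ : InjectiveResolution S.X₁ := { cocomplex := K.X₁, ι := φ.τ₁, quasiIso := hφ }
  exact ⟨⟨I₁, I₂, I₃, ⟨K.f, HomologicalComplex.congr_hom φ.comm₁₂ 0⟩, g, _, hK⟩⟩

end Horseshoe

section RightDerived

open HomologicalComplex ComposableArrows

variable {C : Type*} [Category* C] [Abelian C] {D : Type*} [Category* D] [Abelian D]
  (F : C ⥤ D) [F.Additive] {S : ShortComplex C}

theorem rightDerived_map_comp_isoRightDerivedObj_hom [HasInjectiveResolutions C] {X Y : C}
    {f : X ⟶ Y} {I : InjectiveResolution X} {J : InjectiveResolution Y} (φ : I.Hom J f) (n : ℕ) :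
    (F.rightDerived n).map f ≫ (J.isoRightDerivedObj F n).hom =
      (I.isoRightDerivedObj F n).hom ≫
        homologyMap ((F.mapHomologicalComplex _).map φ.hom) n := by
  refine InjectiveResolution.isoRightDerivedObj_hom_naturality f I J φ.hom ?_ F n
  rw [φ.ι_f_zero_comp_hom_f_zero, CochainComplex.single₀_map_f_zero]
  rfl

namespace Horseshoe

variable (H : Horseshoe S)

/-- The image of a horseshoe under an additive functor, as a short complex of cochain complexes. -/
abbrev mapShortComplex : ShortComplex (CochainComplex D ℕ) :=
  (ShortComplex.mk H.f.hom H.g.hom H.zero).map (F.mapHomologicalComplex _)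

theorem mapShortComplex_shortExact : (H.mapShortComplex F).ShortExact :=
  shortExact_of_degreewise_shortExact _ fun n =>
    have : Injective ((ShortComplex.mk H.f.hom H.g.hom H.zero).map (eval C _ n)).X₁ :=
      H.res₁.injective n
    ((H.shortExact.map_of_exact (eval C _ n)).splittingOfInjective.map F).shortExact

variable [HasInjectiveResolutions C]

theorem map_f_isoRightDerivedObj_hom (n : ℕ) :
    (F.rightDerived n).map S.f ≫ (H.res₂.isoRightDerivedObj F n).hom =
      (H.res₁.isoRightDerivedObj F n).hom ≫ homologyMap (H.mapShortComplex F).f n :=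
  rightDerived_map_comp_isoRightDerivedObj_hom F H.f n

theorem map_g_isoRightDerivedObj_hom (n : ℕ) :
    (F.rightDerived n).map S.g ≫ (H.res₃.isoRightDerivedObj F n).hom =
      (H.res₂.isoRightDerivedObj F n).hom ≫ homologyMap (H.mapShortComplex F).g n :=
  rightDerived_map_comp_isoRightDerivedObj_hom F H.g n

/-- The connecting morphism of the long exact sequence of right derived functors, computed from the
chosen resolutions. -/
noncomputable def δ (n : ℕ) :
    (F.rightDerived n).obj S.X₃ ⟶ (F.rightDerived (n + 1)).obj S.X₁ :=
  ((H.res₃.isoRightDerivedObj F n).hom ≫ (H.mapShortComplex_shortExact F).δ n (n + 1) rfl) ≫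
    (H.res₁.isoRightDerivedObj F (n + 1)).inv

theorem δ_isoRightDerivedObj_hom (n : ℕ) :
    H.δ F n ≫ (H.res₁.isoRightDerivedObj F (n + 1)).hom =
      (H.res₃.isoRightDerivedObj F n).hom ≫ (H.mapShortComplex_shortExact F).δ n (n + 1) rfl :=
  (Iso.eq_comp_inv _).1 rfl

/-- The part of the long exact sequence of right derived functors that involves the degrees `n` and
`n + 1`. -/
noncomputable abbrev rightDerivedSequence (n : ℕ) : ComposableArrows D 5 :=
  mk₅ ((F.rightDerived n).map S.f) ((F.rightDerived n).map S.g) (H.δ F n)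
    ((F.rightDerived (n + 1)).map S.f) ((F.rightDerived (n + 1)).map S.g)

theorem rightDerivedSequence_exact (n : ℕ) : (H.rightDerivedSequence F n).Exact :=
  exact_of_iso
    (isoMk₅ (H.res₁.isoRightDerivedObj F n) (H.res₂.isoRightDerivedObj F n)
      (H.res₃.isoRightDerivedObj F n) (H.res₁.isoRightDerivedObj F (n + 1))
      (H.res₂.isoRightDerivedObj F (n + 1)) (H.res₃.isoRightDerivedObj F (n + 1))
      (H.map_f_isoRightDerivedObj_hom F n) (H.map_g_isoRightDerivedObj_hom F n)
      (H.δ_isoRightDerivedObj_hom F n) (H.map_f_isoRightDerivedObj_hom F (n + 1))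
      (H.map_g_isoRightDerivedObj_hom F (n + 1))).symm
    (HomologySequence.composableArrows₅_exact (H.mapShortComplex_shortExact F) n (n + 1) rfl)

end Horseshoe

variable [EnoughInjectives C]

theorem exists_rightDerivedSequence_exact (hS : S.ShortExact) (n : ℕ) :
    ∃ δ : (F.rightDerived n).obj S.X₃ ⟶ (F.rightDerived (n + 1)).obj S.X₁,
      (mk₅ ((F.rightDerived n).map S.f) ((F.rightDerived n).map S.g) δ
        ((F.rightDerived (n + 1)).map S.f) ((F.rightDerived (n + 1)).map S.g)).Exact :=
  have ⟨H⟩ := nonempty_horseshoe hS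
  ⟨H.δ F n, H.rightDerivedSequence_exact F n⟩

variable {F}

theorem epi_rightDerived_map_f (hS : S.ShortExact) (n : ℕ)
    (h : IsZero ((F.rightDerived n).obj S.X₃)) : Epi ((F.rightDerived n).map S.f) :=
  have ⟨_, hδ⟩ := exists_rightDerivedSequence_exact F hS n
  (hδ.exact 0).epi_f (h.eq_of_tgt _ _)

theorem isIso_rightDerived_succ_map_f (hS : S.ShortExact) (n : ℕ)
    (h : IsZero ((F.rightDerived n).obj S.X₃)) (h' : IsZero ((F.rightDerived (n + 1)).obj S.X₃)) :
    IsIso ((F.rightDerived (n + 1)).map S.f) :=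
  have ⟨_, hδ⟩ := exists_rightDerivedSequence_exact F hS n
  hδ.isIso_map' 2 (by omega) (h.eq_of_src _ _) (h'.eq_of_tgt _ _)

theorem isZero_rightDerived_succ_of_mono_injective {X L : C} (i : X ⟶ L) [Mono i] [Injective L]
    (n : ℕ) [Epi ((F.rightDerived n).map (cokernel.π i))] :
    IsZero ((F.rightDerived (n + 1)).obj X) := by
  have hS : (ShortComplex.mk i _ (cokernel.condition i)).ShortExact :=
    { exact := ShortComplex.exact_cokernel i }
  obtain ⟨δ, hδ⟩ := exists_rightDerivedSequence_exact F hS n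
  have hδ_zero : δ = 0 := by
    rw [← cancel_epi ((F.rightDerived n).map (cokernel.π i)), comp_zero]
    exact hδ.zero 1
  exact (hδ.exact 2).isZero_X₂ hδ_zero
    ((F.isZero_rightDerived_obj_injective_succ n L).eq_of_tgt _ _)

theorem epi_rightDerived_zero_map_iff [PreservesFiniteLimits F] {X Y : C} (p : X ⟶ Y) :
    Epi ((F.rightDerived 0).map p) ↔ Epi (F.map p) :=
  (MorphismProperty.epimorphisms D).arrow_mk_iso_iff
    (Arrow.isoOfNatIso F.rightDerivedZeroIsoSelf (Arrow.mk p))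

theorem isZero_rightDerived_succ [PreservesFiniteLimits F] (P : ObjectProperty C)
    [P.IsClosedUnderQuotients]
    (hP : ∀ ⦃X⦄, P X → ∃ (L : C) (i : X ⟶ L), Injective L ∧ Mono i ∧ P L)
    (hF : ∀ ⦃X Y⦄ (p : X ⟶ Y) [Epi p], P X → Epi (F.map p)) (n : ℕ) {X : C} (hX : P X) :
    IsZero ((F.rightDerived (n + 1)).obj X) := by
  induction n generalizing X with
  | zero =>
    obtain ⟨L, i, _, _, hL⟩ := hP hX
    have := (epi_rightDerived_zero_map_iff _).2 (hF (cokernel.π i) hL)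
    exact isZero_rightDerived_succ_of_mono_injective i 0
  | succ n ih =>
    obtain ⟨L, i, _, _, hL⟩ := hP hX
    have := (ih (P.prop_of_epi (cokernel.π i) hL)).epi ((F.rightDerived (n + 1)).map (cokernel.π i))
    exact isZero_rightDerived_succ_of_mono_injective i (n + 1)

end RightDerived

namespace FIMod

variable {k : Type u} [Ring k]

theorem exact_iff {S : ShortComplex (FIMod k)} :
    S.Exact ↔ ∀ (X : FI) (x : S.X₂.obj X), S.g.app X x = 0 → ∃ y, S.f.app X y = x := by
  let ev (X : FI) := (evaluation FI (ModuleCat.{u} k)).obj X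
  refine ⟨fun hS X => (ShortComplex.moduleCat_exact_iff _).1 (hS.map (ev X)), fun h => ?_⟩
  rw [ShortComplex.exact_iff_isZero_homology]
  refine Functor.isZero _ fun X => IsZero.of_iso ?_ (S.mapHomologyIso (ev X)).symm
  rw [← ShortComplex.exact_iff_isZero_homology]
  exact (ShortComplex.moduleCat_exact_iff _).2 (h X)

theorem mono_iff_injective {V W : FIMod k} (φ : V ⟶ W) :
    Mono φ ↔ ∀ S, Function.Injective (φ.app S) := by
  simp only [NatTrans.mono_iff_mono_app, ModuleCat.mono_iff_injective]

theorem epi_iff_surjective {V W : FIMod k} (φ : V ⟶ W) :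
    Epi φ ↔ ∀ S, Function.Surjective (φ.app S) := by
  simp only [NatTrans.epi_iff_epi_app, ModuleCat.epi_iff_surjective]

theorem map_app {V W : FIMod k} (φ : V ⟶ W) {S T : FI} (f : S ⟶ T) (x : V.obj S) :
    φ.app T (V.map f x) = W.map f (φ.app S x) := by
  rw [← ModuleCat.comp_apply, ← ModuleCat.comp_apply, φ.naturality]

instance torsion_preservesFiniteLimits : PreservesFiniteLimits (torsion k) := by
  rw [Functor.preservesFiniteLimits_iff_forall_exact_map_and_mono]
  intro S hS
  have hinj := (mono_iff_injective _).1 hS.mono_f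
  constructor
  · refine exact_iff.2 fun X x hx => ?_
    obtain ⟨y, hy⟩ := exact_iff.1 hS.exact X x.1 (congrArg Subtype.val hx)
    obtain ⟨T, f, hf⟩ := x.2
    refine ⟨⟨y, T, f, hinj T ?_⟩, Subtype.ext hy⟩
    rw [map_app, hy, hf, map_zero]
  · exact (mono_iff_injective _).2 fun X x y h => Subtype.ext (hinj X (congrArg Subtype.val h))

/-- The inclusion of the torsion submodule `H⁰_𝔪(V)` in `V`. -/
def torsionι (V : FIMod k) : (torsion k).obj V ⟶ V where
  app S := ModuleCat.ofHom (V.torsionSub.carrier S).subtype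
  naturality _ _ _ := rfl

instance (V : FIMod k) : Mono V.torsionι :=
  (mono_iff_injective _).2 fun _ => Subtype.val_injective

/-- The property of an `FI`-module of being zero on all finite sets with at least `N` elements. -/
def VanishesFrom (N : ℕ) : ObjectProperty (FIMod k) := fun V =>
  ∀ S : FI, N ≤ S.card → Subsingleton (V.obj S)

instance (N : ℕ) : (VanishesFrom (k := k) N).IsClosedUnderQuotients where
  prop_of_epi p _ hV S hS :=
    have := hV S hS
    ((epi_iff_surjective p).1 inferInstance S).subsingleton

theorem _root_.FI.exists_hom_card_ge (S : FI) (N : ℕ) : ∃ (T : FI) (_ : S ⟶ T), N ≤ T.card := by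
  let i : S.carrier ↪ S.carrier ⊕ Fin N := ⟨Sum.inl, Sum.inl_injective⟩
  exact ⟨⟨S.carrier ⊕ Fin N⟩, i, by simp [FI.card]⟩

namespace VanishesFrom

variable {N : ℕ} {V W : FIMod k}

theorem mem_torsionSub (hV : VanishesFrom N V) {S : FI} (x : V.obj S) :
    x ∈ V.torsionSub.carrier S := by
  obtain ⟨T, f, hT⟩ := S.exists_hom_card_ge N
  have := hV T hT
  exact ⟨T, f, Subsingleton.elim _ _⟩

theorem epi_torsion_map (hV : VanishesFrom N V) (p : V ⟶ W) [Epi p] :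
    Epi ((torsion k).map p) := by
  refine (epi_iff_surjective _).2 fun S y => ?_
  obtain ⟨x, hx⟩ := (epi_iff_surjective p).1 inferInstance S y.1
  exact ⟨⟨x, hV.mem_torsionSub x⟩, Subtype.ext hx⟩

theorem exists_mono_injective (hV : VanishesFrom N V) :
    ∃ (L : FIMod k) (i : V ⟶ L), Injective L ∧ Mono i ∧ VanishesFrom N L := by
  let a (n : Fin N) : FI := FI.std n
  refine ⟨coinducedHull V a, coinducedHull.ι V a, inferInstance,
    coinducedHull.mono_ι V a fun S => ?_, fun S hS => ?_⟩
  · by_cases hS : N ≤ S.card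
    · exact .inr (ModuleCat.isZero_iff_subsingleton.2 (hV S hS))
    · exact .inl ⟨⟨S.card, not_le.1 hS⟩, S.exists_iso_std⟩
  · have (n : Fin N) : IsEmpty (S ⟶ a n) :=
      ⟨fun f => n.2.not_ge (hS.trans ((FI.card_le f).trans_eq (FI.card_std n)))⟩
    exact ModuleCat.isZero_iff_subsingleton.1 (coinducedHull.isZero_obj V a S)

theorem isZero_locoh_succ (hV : VanishesFrom N V) (j : ℕ) : IsZero ((locoh k (j + 1)).obj V) :=
  isZero_rightDerived_succ (VanishesFrom N) (fun _ h => exists_mono_injective h)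
    (fun _ _ p _ h => epi_torsion_map h p) j hV

theorem degree_le (hV : VanishesFrom N V) : V.degree ≤ (((N : ℤ) - 1 : ℤ) : WithTop ℤ) := by
  refine (degree_le_iff _ _).2 ⟨WithTop.coe_le_coe.2 (by omega), fun S hS => hV S ?_⟩
  have := WithTop.coe_lt_coe.1 hS
  omega

end VanishesFrom

theorem degree_mono {V W : FIMod k}
    (h : ∀ S : FI, Subsingleton (W.obj S) → Subsingleton (V.obj S)) : V.degree ≤ W.degree := by
  have hW := (degree_le_iff W W.degree).1 le_rfl
  exact (degree_le_iff _ _).2 ⟨hW.1, fun S hS => h S (hW.2 S hS)⟩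

theorem degree_le_of_mono {V W : FIMod k} (φ : V ⟶ W) [Mono φ] : V.degree ≤ W.degree :=
  degree_mono fun S _ => ((mono_iff_injective φ).1 inferInstance S).subsingleton

theorem degree_le_of_epi {V W : FIMod k} (φ : V ⟶ W) [Epi φ] : W.degree ≤ V.degree :=
  degree_mono fun S _ => ((epi_iff_surjective φ).1 inferInstance S).subsingleton

theorem degree_eq_of_iso {V W : FIMod k} (e : V ≅ W) : V.degree = W.degree :=
  le_antisymm (degree_le_of_mono e.hom) (degree_le_of_mono e.inv)

theorem degree_le_max_of_exact {S : ShortComplex (FIMod k)} (hS : S.Exact) :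
    S.X₂.degree ≤ max S.X₁.degree S.X₃.degree := by
  have h₁ := (degree_le_iff S.X₁ _).1 le_rfl
  have h₃ := (degree_le_iff S.X₃ _).1 le_rfl
  refine (degree_le_iff _ _).2 ⟨h₁.1.trans (le_max_left _ _), fun X hX => ?_⟩
  have := h₁.2 X ((le_max_left _ _).trans_lt hX)
  have := h₃.2 X ((le_max_right _ _).trans_lt hX)
  refine subsingleton_of_forall_eq 0 fun x => ?_
  obtain ⟨y, rfl⟩ := exact_iff.1 hS X x (Subsingleton.elim _ _)
  rw [Subsingleton.elim y 0, map_zero]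

theorem locohDegree_zero (V : FIMod k) : locohDegree 0 V = ((torsion k).obj V).degree :=
  degree_eq_of_iso ((torsion k).rightDerivedZeroIsoSelf.app V)

theorem locohDegree_zero_le_degree (V : FIMod k) : locohDegree 0 V ≤ V.degree :=
  V.locohDegree_zero.trans_le (degree_le_of_mono V.torsionι)

theorem locohDegree_zero_le_of_mono {V W : FIMod k} (φ : V ⟶ W) [Mono φ] :
    locohDegree 0 V ≤ locohDegree 0 W := by
  rw [locohDegree_zero, locohDegree_zero]
  exact degree_le_of_mono ((torsion k).map φ)

theorem locohDegree_X₂_le_max {S : ShortComplex (FIMod k)} (hS : S.ShortExact) (j : ℕ) :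
    locohDegree j S.X₂ ≤ max (locohDegree j S.X₁) (locohDegree j S.X₃) :=
  have ⟨_, hδ⟩ := exists_rightDerivedSequence_exact (torsion k) hS j
  degree_le_max_of_exact (hδ.exact 0)

theorem locohDegree_succ_X₁_le_max {S : ShortComplex (FIMod k)} (hS : S.ShortExact) (j : ℕ) :
    locohDegree (j + 1) S.X₁ ≤ max (locohDegree j S.X₃) (locohDegree (j + 1) S.X₂) :=
  have ⟨_, hδ⟩ := exists_rightDerivedSequence_exact (torsion k) hS j
  degree_le_max_of_exact (hδ.exact 2)

/-- The inclusion of the truncation `V_{≥ N}` in `V`. -/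
noncomputable def truncι (V : FIMod k) (N : ℕ) : V.trunc N ⟶ V where
  app S := ModuleCat.ofHom ((V.truncSub N).carrier S).subtype
  naturality _ _ _ := rfl

instance (V : FIMod k) (N : ℕ) : Mono (V.truncι N) :=
  (mono_iff_injective _).2 fun _ => Subtype.val_injective

theorem truncι_app_surjective (V : FIMod k) {N : ℕ} {S : FI} (hS : N ≤ S.card) :
    Function.Surjective ((V.truncι N).app S) := fun x =>
  ⟨⟨x, by simp [truncSub, hS]⟩, rfl⟩

/-- The short exact sequence `0 → V_{≥ N} → V → V / V_{≥ N} → 0`. -/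
noncomputable abbrev truncShortComplex (V : FIMod k) (N : ℕ) : ShortComplex (FIMod k) :=
  ShortComplex.mk (V.truncι N) (cokernel.π (V.truncι N)) (cokernel.condition _)

theorem truncShortComplex_shortExact (V : FIMod k) (N : ℕ) :
    (V.truncShortComplex N).ShortExact where
  exact := ShortComplex.exact_cokernel _

theorem vanishesFrom_cokernel_truncι (V : FIMod k) (N : ℕ) :
    VanishesFrom N (cokernel (V.truncι N)) := by
  intro S hS
  refine subsingleton_of_forall_eq 0 fun y => ?_
  obtain ⟨x, rfl⟩ := (epi_iff_surjective (cokernel.π (V.truncι N))).1 inferInstance S y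
  obtain ⟨z, rfl⟩ := V.truncι_app_surjective hS x
  rw [← ModuleCat.comp_apply, ← NatTrans.comp_app, cokernel.condition]
  rfl

end FIMod

theorem mainTheorem9 (k : Type u) [Ring k] (V : FIMod k) (N : ℕ) :
    (FIMod.locohDegree 0 (V.trunc N) ≤ FIMod.locohDegree 0 V ∧
      FIMod.locohDegree 0 V ≤
        max (FIMod.locohDegree 0 (V.trunc N)) (((N : ℤ) - 1 : ℤ) : WithTop ℤ)) ∧
    (FIMod.locohDegree 1 V ≤ FIMod.locohDegree 1 (V.trunc N) ∧
      FIMod.locohDegree 1 (V.trunc N) ≤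
        max (((N : ℤ) - 1 : ℤ) : WithTop ℤ) (FIMod.locohDegree 1 V)) ∧
    ∀ j : ℕ, 2 ≤ j → FIMod.locohDegree j V = FIMod.locohDegree j (V.trunc N) := by
  have hS := V.truncShortComplex_shortExact N
  have hQ := V.vanishesFrom_cokernel_truncι N
  have hQ₀ := (FIMod.locohDegree_zero_le_degree _).trans hQ.degree_le
  refine ⟨⟨FIMod.locohDegree_zero_le_of_mono (V.truncι N), ?_⟩, ⟨?_, ?_⟩, fun j hj => ?_⟩
  · exact (FIMod.locohDegree_X₂_le_max hS 0).trans (max_le_max_left _ hQ₀)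
  · have : Epi ((FIMod.locoh k 1).map (V.truncι N)) :=
      epi_rightDerived_map_f hS 1 (hQ.isZero_locoh_succ 0)
    exact FIMod.degree_le_of_epi ((FIMod.locoh k 1).map (V.truncι N))
  · exact (FIMod.locohDegree_succ_X₁_le_max hS 0).trans (max_le_max_right _ hQ₀)
  · obtain ⟨n, rfl⟩ := Nat.exists_eq_add_of_le' hj
    have : IsIso ((FIMod.locoh k (n + 2)).map (V.truncι N)) :=
      isIso_rightDerived_succ_map_f hS (n + 1) (hQ.isZero_locoh_succ n)
        (hQ.isZero_locoh_succ (n + 1))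
    exact (FIMod.degree_eq_of_iso (asIso ((FIMod.locoh k (n + 2)).map (V.truncι N)))).symm
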